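/- Let $d\ge 0$ be an integer and $s\ge 0$ a real number. For $A\subset\mathbb R^d$ (with the Euclidean metric) let $$\mathcal H^s_\infty(A)=\inf\Big\{\sum_{i}(\operatorname{diam} D_i)^s \;:\; A\subset\bigcup_i D_i\Big\}$$ be the Hausdorff content, the infimum being over all finite or countably infinite (possibly empty) families $(D_i)$ of closed balls of positive radius that cover $A$ (with $0^0=1$). For a Borel set $E\subset\mathbb R^d$ let $$\varphi^s(E)=\sup_\mu\ \inf_{x\in E}\ \inf_{r>0}\ \frac{r^s}{\mu(B_r(x))}\in[0,\infty]$$ be the generalized singular value function, where the supremum is over all Borel probability measures $\mu$ on $\mathbb R^d$ with $\mu(\mathbb R^d\setminus E)=0$, $B_r(x)$ is the open ball of radius $r$ centred at $x$, a quotient with $\mu(B_r(x))=0$ is read as $\infty$, and $\varphi^s(\emptyset)=0$. **Proposition.** For every bounded Borel set $E\subset\mathbb R^d$, $$\varphi^s(E)\le\mathcal H^s_\infty(E)\le 6^s\,\varphi^s(E).$$ -/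

import Mathlib

open scoped ENNReal
open MeasureTheory

/-- The `s`-dimensional Hausdorff content of `A`: the infimum of `∑ᵢ (diam Dᵢ) ^ s` over all at most
countable families `(Dᵢ)` of closed balls of positive radius that cover `A`. The family is indexed
by a set `I ⊆ ℕ`, so that finite families (and, for `A = ∅`, the empty family) are allowed; for
`0 < s` this is the same as allowing only infinite sequences. -/
noncomputable def hausdorffContent {X : Type*} [MetricSpace X] (s : ℝ) (A : Set X) : ℝ≥0∞ :=
  ⨅ (I : Set ℕ) (c : I → X) (r : I → ℝ) (_ : ∀ i, 0 < r i)
    (_ : A ⊆ ⋃ i, Metric.closedBall (c i) (r i)),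
    ∑' i, Metric.ediam (Metric.closedBall (c i) (r i)) ^ s

/-- The generalized singular value function `φ^s(E)`: the supremum, over Borel probability measures
`μ` that give no mass to the complement of `E`, of the infimum of `r ^ s / μ (B_r(x))` over `x ∈ E`
and `r > 0`. It takes values in `[0, ∞]`; a quotient with `μ (B_r(x)) = 0` is `∞`, and the
supremum is `0` when `E` is empty. -/
noncomputable def singularValue {X : Type*} [MetricSpace X] [MeasurableSpace X]
    (s : ℝ) (E : Set X) : ℝ≥0∞ :=
  ⨆ (μ : Measure X) (_ : IsProbabilityMeasure μ) (_ : μ Eᶜ = 0),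
    ⨅ (x : X) (_ : x ∈ E) (r : ℝ) (_ : 0 < r), ENNReal.ofReal r ^ s / μ (Metric.ball x r)

/-! The first inequality is the mass distribution principle: a measure with `b * μ(B_r(x)) ≤ r ^ s`
at points of `E` gives `b * μ(D) ≤ (diam D) ^ s` for each ball `D` meeting `E`; sum over a cover.

The second is Frostman's lemma. For compact `K` with content above `6 ^ s * l`, a probability
measure on `K` with `μ(B_r(x)) ≤ r ^ s / l` is sought. By weak compactness finitely many balls
suffice, and Hahn–Banach (`exists_probabilityMeasure_real_lt`) turns these into a statement on
fractional covers. A fractional cover costs at least as much as a cover by tripled balls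
(`mul_le_sum_of_fractional_cover`, from Vitali), so `6 = 2 * 3`: diameter against radius, times the
Vitali factor.

A bounded Borel `E` is reduced to compact subsets by capacitability
(`AnalyticSet.exists_isCompact_forall_isOpen`). The continuity along increasing sets that this needs
is proved for covers from a discretized family of balls (`exists_lt_coverContent_of_iUnion`,
`exists_countable_ball_family`), at the price of a radius factor that tends to `1`. -/

open Set Filter Topology

universe u

/-! ### Contents from weighted covers; the increasing sets lemma -/

section CoverContent

variable {X ι : Type*}

/-- The cheapest member of the family `B` that contains a given set. -/
noncomputable def coverCost (B : ι → Set X) (w : ι → ℝ≥0∞) (A : Set X) : ℝ≥0∞ :=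
  ⨅ (i) (_ : A ⊆ B i), w i

/-- The outer measure of covers by members of a weighted family of sets. -/
noncomputable def coverContent (B : ι → Set X) (w : ι → ℝ≥0∞) : OuterMeasure X :=
  OuterMeasure.boundedBy (coverCost B w)

lemma coverCost_le (B : ι → Set X) (w : ι → ℝ≥0∞) (i : ι) : coverCost B w (B i) ≤ w i :=
  iInf₂_le i Subset.rfl

lemma OuterMeasure.le_tsum_of_subset_biUnion [Countable ι] (μ : OuterMeasure X) {B : ι → Set X}
    {w : ι → ℝ≥0∞} {S : Set ι} {A : Set X} (hA : A ⊆ ⋃ i ∈ S, B i) (h : ∀ i ∈ S, μ (B i) ≤ w i) :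
    μ A ≤ ∑' i, S.indicator w i := by
  calc μ A ≤ μ (⋃ i ∈ S, B i) := μ.mono hA
    _ ≤ ∑' i : S, μ (B i) := measure_biUnion_le μ S.to_countable B
    _ ≤ ∑' i : S, w i := ENNReal.tsum_le_tsum fun i => h i i.2
    _ = _ := tsum_subtype S w

lemma coverContent_le [Countable ι] {B : ι → Set X} {w : ι → ℝ≥0∞} {S : Set ι} {A : Set X}
    (hA : A ⊆ ⋃ i ∈ S, B i) : coverContent B w A ≤ ∑' i, S.indicator w i :=
  OuterMeasure.le_tsum_of_subset_biUnion _ hA fun i _ =>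
    (OuterMeasure.boundedBy_le _).trans (coverCost_le B w i)

/-- `boundedBy` covers by arbitrary sets; each nonempty one is replaced by a member of the family
containing it, with a summable error in cost. A member chosen repeatedly is paid for once. -/
lemma exists_cover_of_coverContent_lt {B : ι → Set X} {w : ι → ℝ≥0∞} {A : Set X} {a : ℝ≥0∞}
    (h : coverContent B w A < a) :
    ∃ S : Set ι, A ⊆ ⋃ i ∈ S, B i ∧ ∑' i, S.indicator w i < a := by
  rw [coverContent, OuterMeasure.boundedBy_apply] at h
  simp only [iInf_lt_iff] at h
  obtain ⟨t, ht, hlt⟩ := h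
  set v : ℕ → ℝ≥0∞ := fun n => ⨆ _ : (t n).Nonempty, coverCost B w (t n) with hv
  obtain ⟨ε, hε, hεs⟩ := ENNReal.exists_pos_sum_of_countable' (tsub_pos_of_lt hlt).ne' ℕ
  have hvtop : ∀ n, v n ≠ ∞ := fun n =>
    ((ENNReal.le_tsum n).trans_lt (hlt.trans_le le_top)).ne
  have key : ∀ n : {n // (t n).Nonempty}, ∃ i, t n ⊆ B i ∧ w i < v n + ε n := by
    intro n
    have h1 : coverCost B w (t n) < v n + ε n := by
      have : v n = coverCost B w (t n) := by simp [hv, n.2]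
      rw [← this]
      exact ENNReal.lt_add_right (hvtop n) (hε n).ne'
    simpa [coverCost, iInf_lt_iff] using h1
  choose f hf hfw using key
  refine ⟨range f, fun x hx => ?_, ?_⟩
  · obtain ⟨n, hn⟩ := mem_iUnion.1 (ht hx)
    exact mem_biUnion (mem_range_self ⟨n, ⟨x, hn⟩⟩) (hf ⟨n, ⟨x, hn⟩⟩ hn)
  · calc ∑' i, (range f).indicator w i = ∑' i : range f, w i := (tsum_subtype _ _).symm
      _ = ∑' i : range f, w (f (rangeSplitting f i)) := by simp [apply_rangeSplitting]
      _ ≤ ∑' n, w (f n) :=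
        ENNReal.tsum_comp_le_tsum_of_injective (rangeSplitting_injective f) fun n => w (f n)
      _ ≤ ∑' n : {n // (t n).Nonempty}, (v n + ε n) := ENNReal.tsum_le_tsum fun n => (hfw n).le
      _ ≤ ∑' n, (v n + ε n) :=
        ENNReal.tsum_comp_le_tsum_of_injective Subtype.val_injective fun n => v n + ε n
      _ = ∑' n, v n + ∑' n, ε n := ENNReal.tsum_add
      _ < a := by
        have hs : ∑' n, v n ≠ ∞ := (hlt.trans_le le_top).ne
        calc ∑' n, v n + ∑' n, ε n < ∑' n, v n + (a - ∑' n, v n) :=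
              ENNReal.add_lt_add_left hs hεs
          _ = a := add_tsub_cancel_of_le hlt.le

/-- **Increasing sets lemma**: the content given by covers with members of a countable family of
closed sets, only finitely many of which have diameter above any given positive number, is
continuous along increasing sequences of arbitrary sets. -/
theorem exists_lt_coverContent_of_iUnion [EMetricSpace X] [Countable ι] {B : ι → Set X}
    {w : ι → ℝ≥0∞} (hB : ∀ i, IsClosed (B i))
    (hfin : ∀ δ : ℝ≥0∞, 0 < δ → {i | δ < Metric.ediam (B i)}.Finite)
    {E : ℕ → Set X} (hE : Monotone E) {a : ℝ≥0∞} (h : a < coverContent B w (⋃ n, E n)) :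
    ∃ n, a < coverContent B w (E n) := by
  by_contra! hcon
  refine h.not_ge (le_of_forall_gt_imp_ge_of_dense fun b hb => ?_)
  choose S hSE hSw using fun n => exists_cover_of_coverContent_lt ((hcon n).trans_lt hb)
  let 𝒰 : Ultrafilter ℕ := hyperfilter ℕ
  -- The ultrafilter limit of the covers `S n`. It may miss part of the union, since members of `S
  -- n` can shrink to points; that part is `F`.
  set T : Set ι := {i | ∀ᶠ n in 𝒰, i ∈ S n} with hT
  have hlim : ∀ i, ∀ᶠ n in 𝒰, (i ∈ S n ↔ i ∈ T) := by
    intro i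
    by_cases hi : i ∈ T
    · filter_upwards [show ∀ᶠ n in 𝒰, i ∈ S n from hi] with n hn
      simp [hn, hi]
    · have : ∀ᶠ n in 𝒰, i ∉ S n := Ultrafilter.eventually_not.2 hi
      filter_upwards [this] with n hn
      simp [hn, hi]
  set m := coverCost B w
  set F : Set X := (⋃ i ∈ T, B i)ᶜ with hF
  -- For suitable large `k`, `S k` and `T` agree on `Q` and on the finitely many members of diameter
  -- above `δ`. So `S k` pays for `Q ∩ T` and, separately, covers `F ∩ E n` by members of diameter
  -- at most `δ`.
  have key : ∀ n : ℕ, ∀ δ : ℝ≥0∞, 0 < δ → ∀ Q : Finset ι,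
      OuterMeasure.mkMetric'.pre m δ (F ∩ E n) + ∑ i ∈ Q, T.indicator w i ≤ b := by
    intro n δ hδ Q
    set Q' : Set ι := Q ∪ {i | δ < Metric.ediam (B i)}
    have hQ' : Q'.Finite := Q.finite_toSet.union (hfin δ hδ)
    have h1 : ∀ᶠ k in 𝒰, ∀ i ∈ Q', (i ∈ S k ↔ i ∈ T) :=
      (eventually_all_finite hQ').2 fun i _ => hlim i
    have h2 : ∀ᶠ k in (𝒰 : Filter ℕ), n ≤ k :=
      (Nat.cofinite_eq_atTop ▸ hyperfilter_le_cofinite : (𝒰 : Filter ℕ) ≤ atTop)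
        (eventually_ge_atTop n)
    obtain ⟨k, hk, hnk⟩ := (h1.and h2).exists
    have h3 : OuterMeasure.mkMetric'.pre m δ (F ∩ E n) ≤ ∑' i, (S k \ Q').indicator w i := by
      refine OuterMeasure.le_tsum_of_subset_biUnion (B := B) _ ?_ ?_
      · rintro x ⟨hxF, hxE⟩
        obtain ⟨i, hi, hxi⟩ := mem_iUnion₂.1 (hSE k (hE hnk hxE))
        refine mem_biUnion ⟨hi, fun hiQ => hxF ?_⟩ hxi
        exact mem_biUnion ((hk i hiQ).1 hi) hxi
      · rintro i ⟨_, hi⟩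
        refine (OuterMeasure.mkMetric'.pre_le ?_).trans (coverCost_le B w i)
        by_contra! hd
        exact hi (Or.inr hd)
    have h4 : ∑ i ∈ Q, T.indicator w i ≤ ∑' i, (S k ∩ Q').indicator w i := by
      refine le_trans (Finset.sum_le_sum fun i hi => ?_) (ENNReal.sum_le_tsum Q)
      by_cases hiT : i ∈ T
      · have hiQ : i ∈ Q' := Or.inl hi
        simp [hiT, hiQ, (hk i hiQ).2 hiT]
      · simp [hiT]
    calc _ ≤ ∑' i, (S k \ Q').indicator w i + ∑' i, (S k ∩ Q').indicator w i := add_le_add h3 h4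
      _ = ∑' i, (S k).indicator w i := by
        rw [← ENNReal.tsum_add]
        refine tsum_congr fun i => ?_
        by_cases h1 : i ∈ S k <;> by_cases h2 : i ∈ Q' <;> simp [h1, h2]
      _ ≤ b := (hSw k).le
  let _ : MeasurableSpace X := borel X
  have : BorelSpace X := ⟨rfl⟩
  set μ : Measure X := Measure.mkMetric' m
  have hμ : ∀ A : Set X, μ A = ⨆ n : ℕ, OuterMeasure.mkMetric'.pre m (n : ℝ≥0∞)⁻¹ A := by
    intro A
    -- Closedness of the `B i` makes the cost closure-invariant, so the formula for `μ` holds on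
    -- nonmeasurable sets too.
    have hcl : ∀ s, m (closure s) = m s := fun s => by
      simp only [m, coverCost, (hB _).closure_subset_iff]
    have : μ.toOuterMeasure = ⨆ n : ℕ, OuterMeasure.mkMetric'.pre m (n : ℝ≥0∞)⁻¹ := by
      rw [Measure.mkMetric'_toOuterMeasure, OuterMeasure.mkMetric'.eq_iSup_nat,
        OuterMeasure.trim_iSup]
      simp_rw [OuterMeasure.mkMetric'.trim_pre m hcl]
    rw [← Measure.coe_toOuterMeasure, this, OuterMeasure.iSup_apply]
  have h5 : μ (F ∩ ⋃ n, E n) + ∑' i, T.indicator w i ≤ b := by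
    have hmono : Monotone fun n => F ∩ E n := fun i j hij => inter_subset_inter_right _ (hE hij)
    rw [inter_iUnion, hmono.measure_iUnion, ENNReal.tsum_eq_iSup_sum, ENNReal.iSup_add]
    refine iSup_le fun n => ?_
    rw [ENNReal.add_iSup]
    refine iSup_le fun Q => ?_
    rw [hμ, ENNReal.iSup_add]
    exact iSup_le fun k => key n _ (by simp) Q
  have h6 : coverContent B w (F ∩ ⋃ n, E n) ≤ μ (F ∩ ⋃ n, E n) := by
    rw [hμ]
    -- At index `0` the size bound is `0⁻¹ = ∞`, hence no restriction.
    refine le_iSup_of_le 0 ?_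
    have : coverContent B w ≤ OuterMeasure.mkMetric'.pre m ((0 : ℕ) : ℝ≥0∞)⁻¹ :=
      OuterMeasure.mkMetric'.le_pre.2 fun s _ => OuterMeasure.boundedBy_le s
    exact this _
  calc coverContent B w (⋃ n, E n)
      ≤ coverContent B w ((F ∩ ⋃ n, E n) ∪ ⋃ i ∈ T, B i) := by
        refine measure_mono fun x hx => ?_
        by_cases hxT : x ∈ ⋃ i ∈ T, B i
        · exact Or.inr hxT
        · exact Or.inl ⟨hxT, hx⟩
    _ ≤ _ := measure_union_le _ _
    _ ≤ _ := add_le_add h6 (coverContent_le Subset.rfl)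
    _ ≤ b := h5

end CoverContent

/-! ### Capacitability of analytic sets -/

section Capacitability

variable {X : Type*}

/-- For a set function that is continuous along increasing sequences, the image of the Baire space
can be exhausted by bounding the coordinates one after the other. -/
lemma exists_bound_prefix {c : Set X → ℝ≥0∞} {a : ℝ≥0∞}
    (hc : ∀ E : ℕ → Set X, Monotone E → a < c (⋃ n, E n) → ∃ n, a < c (E n))
    (f : (ℕ → ℕ) → X) (ha : a < c (range f)) :
    ∃ n : ℕ → ℕ, ∀ k, a < c (f '' {α | ∀ i < k, α i ≤ n i}) := by
  let P : ℕ → (ℕ → ℕ) → Prop := fun k n => a < c (f '' {α | ∀ i < k, α i ≤ n i})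
  have step : ∀ k n, P k n → ∃ j, P (k + 1) (Function.update n k j) := by
    intro k n h
    let E : ℕ → Set X := fun j => f '' {α | ∀ i < k + 1, α i ≤ Function.update n k j i}
    have hE : Monotone E := by
      refine fun j j' hj => image_mono fun α hα i hi => (hα i hi).trans ?_
      rcases eq_or_ne i k with rfl | hik
      · simpa using hj
      · simp [Function.update_of_ne hik]
    refine hc E hE ?_
    refine lt_of_lt_of_eq h (congrArg c ?_)
    ext x
    simp only [E, mem_iUnion, mem_image, mem_ofPred_eq]
    constructor
    · rintro ⟨α, hα, rfl⟩
      refine ⟨α k, α, fun i hi => ?_, rfl⟩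
      rcases Nat.lt_succ_iff_lt_or_eq.1 hi with hi | rfl
      · simpa [Function.update_of_ne hi.ne] using hα i hi
      · simp
    · rintro ⟨j, α, hα, rfl⟩
      refine ⟨α, fun i hi => ?_, rfl⟩
      simpa [Function.update_of_ne hi.ne] using hα i (by omega)
  choose! j hj using step
  let g : ℕ → ℕ → ℕ := fun k =>
    Nat.rec (fun _ => 0) (fun k n => Function.update n k (j k n)) k
  have hg : ∀ k, P k (g k) := by
    intro k
    induction k with
    | zero => simpa [P] using ha
    | succ k ih => exact hj k _ ih
  -- Coordinate `i` is fixed at stage `i + 1`, so the diagonal carries all the bounds.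
  have hgi : ∀ k, ∀ i < k, g k i = g (i + 1) i := by
    intro k
    induction k with
    | zero => simp
    | succ k ih =>
      intro i hi
      rcases Nat.lt_succ_iff_lt_or_eq.1 hi with hi | rfl
      · rw [← ih i hi]
        exact Function.update_of_ne hi.ne _ _
      · rfl
  refine ⟨fun i => g (i + 1) i, fun k => ?_⟩
  have : {α : ℕ → ℕ | ∀ i < k, α i ≤ g (i + 1) i} = {α | ∀ i < k, α i ≤ g k i} := by
    ext α
    exact forall₂_congr fun i hi => by rw [hgi k i hi]
  rw [this]
  exact hg k

/-- Compactness: counterexamples `α k`, truncated by `n`, have an ultrafilter limit in the compact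
box. Truncation changes no coordinate `i < k`, so the `α k` have the same limit, which lies in the
open set `V`. -/
lemma exists_prefix_subset_of_isOpen {V : Set (ℕ → ℕ)} (hV : IsOpen V) {n : ℕ → ℕ}
    (h : {α | ∀ i, α i ≤ n i} ⊆ V) : ∃ k : ℕ, {α | ∀ i < k, α i ≤ n i} ⊆ V := by
  by_contra! hcon
  choose α hα using fun k => not_subset.1 (hcon k)
  let 𝒰 : Ultrafilter ℕ := hyperfilter ℕ
  let β : ℕ → ℕ → ℕ := fun k i => min (α k i) (n i)
  have hK : IsCompact {α : ℕ → ℕ | ∀ i, α i ≤ n i} := by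
    have := isCompact_univ_pi fun i => (finite_Iic (n i)).isCompact
    simpa [Set.pi] using this
  obtain ⟨γ, hγ, hlim⟩ := hK.ultrafilter_le_nhds (𝒰.map β) (by
    simp only [Ultrafilter.coe_map, le_principal_iff]
    exact mem_map.2 (univ_mem' fun k i => min_le_right _ _))
  have h1 : Tendsto β 𝒰 (𝓝 γ) := hlim
  have h2 : Tendsto α 𝒰 (𝓝 γ) := by
    rw [tendsto_pi_nhds] at h1 ⊢
    intro i
    refine (h1 i).congr' ?_
    have h3 : ∀ᶠ k in (𝒰 : Filter ℕ), i < k :=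
      (Nat.cofinite_eq_atTop ▸ hyperfilter_le_cofinite : (𝒰 : Filter ℕ) ≤ atTop)
        (eventually_gt_atTop i)
    filter_upwards [h3] with k hk
    exact min_eq_left ((hα k).1 i hk)
  obtain ⟨k, hk⟩ := (h2.eventually (hV.mem_nhds (h hγ))).exists
  exact (hα k).2 hk

/-- **Capacitability**: if `c` is continuous along increasing sequences, then an analytic set `E`
with `a < c E` has a compact subset all of whose neighborhoods contain sets with `a < c`. -/
theorem AnalyticSet.exists_isCompact_forall_isOpen [TopologicalSpace X]
    {E : Set X} (hE : AnalyticSet E) {c : Set X → ℝ≥0∞} {a : ℝ≥0∞}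
    (hc : ∀ E : ℕ → Set X, Monotone E → a < c (⋃ n, E n) → ∃ n, a < c (E n)) (ha : a < c E) :
    ∃ K ⊆ E, IsCompact K ∧ ∀ U, IsOpen U → K ⊆ U → ∃ A ⊆ U ∩ E, a < c A := by
  rw [AnalyticSet] at hE
  rcases hE with rfl | ⟨f, hf, rfl⟩
  · exact ⟨∅, Subset.rfl, isCompact_empty, fun U _ _ => ⟨∅, empty_subset _, ha⟩⟩
  obtain ⟨n, hn⟩ := exists_bound_prefix hc f ha
  refine ⟨f '' {α | ∀ i, α i ≤ n i}, image_subset_range _ _, ?_, fun U hU hKU => ?_⟩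
  · have := isCompact_univ_pi fun i => (finite_Iic (n i)).isCompact
    refine IsCompact.image ?_ hf
    simpa [Set.pi] using this
  · obtain ⟨k, hk⟩ := exists_prefix_subset_of_isOpen (hU.preimage hf) (image_subset_iff.1 hKU)
    exact ⟨_, subset_inter (image_subset_iff.2 hk) (image_subset_range _ _), hn k⟩

end Capacitability

/-! ### Discretized balls and inner approximation by compact sets -/

section RadiusContent

variable {X : Type*} [MetricSpace X]

/-- The variant of the Hausdorff content in which a closed ball of radius `r` costs `(2 * r) ^ s`. -/
noncomputable def radiusContent (s : ℝ) (A : Set X) : ℝ≥0∞ :=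
  ⨅ (I : Set ℕ) (c : I → X) (r : I → ℝ) (_ : ∀ i, 0 < r i)
    (_ : A ⊆ ⋃ i, Metric.closedBall (c i) (r i)), ∑' i, ENNReal.ofReal (2 * r i) ^ s

lemma hausdorffContent_le_radiusContent {s : ℝ} (hs : 0 ≤ s) (A : Set X) :
    hausdorffContent s A ≤ radiusContent s A := by
  refine iInf_mono fun I => iInf_mono fun c => iInf_mono fun r => iInf_mono fun hr =>
    iInf_mono fun _ => ENNReal.tsum_le_tsum fun i => ENNReal.rpow_le_rpow ?_ hs
  refine Metric.ediam_le_of_forall_dist_le fun x hx y hy => ?_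
  have h1 := Metric.mem_closedBall.1 hx
  have h2 := Metric.mem_closedBall'.1 hy
  linarith [dist_triangle x (c i) y]

lemma radiusContent_le {ι : Type*} [Countable ι] {s : ℝ} {A : Set X} {c : ι → X} {r : ι → ℝ}
    (hr : ∀ i, 0 < r i) (hA : A ⊆ ⋃ i, Metric.closedBall (c i) (r i)) :
    radiusContent s A ≤ ∑' i, ENNReal.ofReal (2 * r i) ^ s := by
  obtain ⟨f, hf⟩ := exists_injective_nat ι
  let e : ι ≃ range f := Equiv.ofInjective f hf
  have hA' : A ⊆ ⋃ i, Metric.closedBall ((c ∘ e.symm) i) ((r ∘ e.symm) i) := by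
    refine hA.trans (iUnion_subset fun i => ?_)
    have := subset_iUnion (fun j => Metric.closedBall ((c ∘ e.symm) j) ((r ∘ e.symm) j)) (e i)
    simpa using this
  have h : radiusContent s A ≤ ∑' i, ENNReal.ofReal (2 * (r ∘ e.symm) i) ^ s := by
    unfold radiusContent
    refine iInf_le_of_le (range f) ?_
    refine iInf_le_of_le (c ∘ e.symm) ?_
    refine iInf_le_of_le (r ∘ e.symm) ?_
    exact iInf₂_le (fun i => hr _) hA'
  exact h.trans_eq <| e.symm.tsum_eq fun i => ENNReal.ofReal (2 * r i) ^ s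

lemma radiusContent_empty (s : ℝ) : radiusContent s (∅ : Set X) = 0 := by
  have h := radiusContent_le (X := X) (ι := Empty) (s := s) (A := ∅) (c := Empty.elim)
    (r := Empty.elim) (fun i => i.elim) (empty_subset _)
  simpa using h

lemma radiusContent_biUnion_le {ι : Type*} [Countable ι] {s : ℝ} {A : Set X} {c : ι → X}
    {r : ι → ℝ} (S : Set ι) (hr : ∀ i ∈ S, 0 < r i)
    (hA : A ⊆ ⋃ i ∈ S, Metric.closedBall (c i) (r i)) :
    radiusContent s A ≤ ∑' i, S.indicator (fun i => ENNReal.ofReal (2 * r i) ^ s) i := by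
  rw [← tsum_subtype]
  refine radiusContent_le (c := fun i : S => c i) (r := fun i : S => r i) (fun i => hr i i.2) ?_
  rwa [biUnion_eq_iUnion] at hA

lemma radiusContent_le_coverContent {ι : Type*} [Countable ι] (s : ℝ) (A : Set X) (c : ι → X)
    {r : ι → ℝ} (hr : ∀ i, 0 < r i) :
    radiusContent s A ≤ coverContent (fun i => Metric.closedBall (c i) (r i))
      (fun i => ENNReal.ofReal (2 * r i) ^ s) A := by
  refine le_of_forall_gt_imp_ge_of_dense fun b hb => ?_
  obtain ⟨S, hS, hb⟩ := exists_cover_of_coverContent_lt hb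
  exact (radiusContent_biUnion_le S (fun i _ => hr i) hS).trans hb.le

/-- Up to a factor `κ > 1` in the radius, all traces of balls on a bounded set are controlled by a
countable family of balls, only finitely many of which have radius above a given positive number. -/
theorem exists_countable_ball_family {X : Type u} [MetricSpace X] [ProperSpace X] {E : Set X}
    (hE : Bornology.IsBounded E) {κ : ℝ} (hκ : 1 < κ) :
    ∃ (ι : Type u) (_ : Countable ι) (c : ι → X) (r : ι → ℝ), (∀ i, 0 < r i) ∧
      (∀ δ : ℝ, 0 < δ → {i | δ < r i}.Finite) ∧
      ∀ y ρ, (Metric.ball y ρ ∩ E).Nonempty →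
        ∃ i, Metric.ball y ρ ∩ E ⊆ Metric.closedBall (c i) (r i) ∧ r i ≤ κ * ρ := by
  rcases E.eq_empty_or_nonempty with rfl | ⟨x₀, hx₀⟩
  · exact ⟨PEmpty, inferInstance, PEmpty.elim, PEmpty.elim, fun i => i.elim, fun _ _ => toFinite _,
      by simp⟩
  obtain ⟨R, hR, hER⟩ : ∃ R : ℝ, 0 < R ∧ E ⊆ Metric.closedBall x₀ R := by
    obtain ⟨R, hR⟩ := hE.subset_closedBall x₀
    exact ⟨max R 1, by positivity, hR.trans (Metric.closedBall_subset_closedBall (le_max_left _ _))⟩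
  -- One factor `t` pays for rounding the radius to a scale `ρ j`, the other for moving the centre
  -- to a net.
  set t := √κ
  have ht : 1 < t := Real.lt_sqrt_of_sq_lt (by linarith)
  have ht0 : 0 < t := by linarith
  have htt : t * t = κ := Real.mul_self_sqrt (by linarith)
  let ρ : ℕ → ℝ := fun j => R * t⁻¹ ^ j
  have hρ : ∀ j, 0 < ρ j := fun j => by positivity
  choose N _ hNf hN using fun j => (isCompact_closedBall x₀ (2 * R)).finite_cover_balls
    (mul_pos (sub_pos.2 ht) (hρ j))
  have hNfin : ∀ j, Finite (N j) := fun j => hNf j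
  let c : Option (Σ j, N j) → X := fun i => i.elim x₀ fun p => p.2
  let r : Option (Σ j, N j) → ℝ := fun i => i.elim R fun p => t * ρ p.1
  refine ⟨Option (Σ j, N j), inferInstance, c, r, ?_, ?_, ?_⟩
  · rintro (_ | p)
    · exact hR
    · exact mul_pos ht0 (hρ _)
  · intro δ hδ
    have hlim : Tendsto (fun j => t * ρ j) atTop (𝓝 0) := by
      have := tendsto_pow_atTop_nhds_zero_of_lt_one (inv_nonneg.2 ht0.le) (inv_lt_one_of_one_lt₀ ht)
      simpa [ρ] using (this.const_mul R).const_mul t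
    have hJ : {j | δ < t * ρ j}.Finite := by
      have := (hlim.eventually_lt_const hδ)
      rw [← Nat.cofinite_eq_atTop, eventually_cofinite] at this
      exact this.subset fun j hj => not_lt.2 (le_of_lt hj)
    have hJ' : ((Sigma.fst : (Σ j, N j) → ℕ) ⁻¹' {j | δ < t * ρ j}).Finite := by
      refine hJ.preimage' fun j _ => ?_
      rw [← range_sigmaMk]
      exact finite_range _
    refine ((finite_singleton none).union (hJ'.image some)).subset ?_
    rintro (_ | p) hp
    · exact Or.inl rfl
    · exact Or.inr ⟨p, hp, rfl⟩
  · rintro y σ ⟨z, hzy, hzE⟩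
    have hσ : 0 < σ := dist_nonneg.trans_lt hzy
    rcases le_or_gt R σ with h | h
    · exact ⟨none, inter_subset_right.trans hER, by change R ≤ κ * σ; nlinarith⟩
    obtain ⟨j, hj1, hj2⟩ := exists_nat_pow_near_of_lt_one (x := σ / R) (by positivity)
      ((div_le_one hR).2 h.le) (inv_pos.2 ht0) (inv_lt_one_of_one_lt₀ ht)
    rw [lt_div_iff₀ hR] at hj1
    rw [div_le_iff₀ hR] at hj2
    have hy : y ∈ Metric.closedBall x₀ (2 * R) := by
      have h1 := Metric.mem_ball'.1 hzy
      have h2 := Metric.mem_closedBall.1 (hER hzE)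
      rw [Metric.mem_closedBall]
      linarith [dist_triangle y z x₀]
    obtain ⟨x, hx, hyx⟩ := mem_iUnion₂.1 (hN j hy)
    refine ⟨some ⟨j, x, hx⟩, inter_subset_left.trans fun w hw => ?_, ?_⟩
    · change dist w x ≤ t * ρ j
      have h1 : dist w y < σ := hw
      have h2 : dist y x < (t - 1) * ρ j := hyx
      have h3 : σ ≤ ρ j := by simpa [ρ, mul_comm] using hj2
      linarith [dist_triangle w y x]
    · change t * (R * t⁻¹ ^ j) ≤ κ * σ
      have : R * t⁻¹ ^ j = t * (t⁻¹ ^ (j + 1) * R) := by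
        rw [pow_succ]; field_simp
      rw [this, ← mul_assoc, htt]
      exact mul_le_mul_of_nonneg_left hj1.le (by linarith)

/-- Approximation of the content of a bounded Borel set from inside by compact sets. -/
theorem exists_isCompact_le_radiusContent {X : Type u} [MetricSpace X] [ProperSpace X]
    [MeasurableSpace X] [BorelSpace X] {E : Set X} (hE : MeasurableSet E)
    (hb : Bornology.IsBounded E) {s : ℝ} (hs : 0 < s) {κ : ℝ} (hκ : 1 < κ) {a : ℝ≥0∞}
    (ha : a < radiusContent s E) :
    ∃ K ⊆ E, IsCompact K ∧ a ≤ ENNReal.ofReal (κ ^ 2) ^ s * radiusContent s K := by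
  have hκ0 : 0 < κ := by linarith
  obtain ⟨ι, _, c, r, hr, hfin, hball⟩ := exists_countable_ball_family hb hκ
  set w : ι → ℝ≥0∞ := fun i => ENNReal.ofReal (2 * r i) ^ s with hw
  set B : ι → Set X := fun i => Metric.closedBall (c i) (r i)
  have hdiam : ∀ δ : ℝ≥0∞, 0 < δ → {i | δ < Metric.ediam (B i)}.Finite := by
    intro δ hδ
    rcases eq_or_ne δ ∞ with rfl | htop
    · simp
    have hδ' : 0 < δ.toReal := ENNReal.toReal_pos hδ.ne' htop
    refine (hfin (δ.toReal / 2) (by positivity)).subset fun i hi => ?_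
    have h1 : Metric.ediam (B i) ≤ ENNReal.ofReal (2 * r i) :=
      Metric.ediam_le_of_forall_dist_le fun x hx y hy => by
        have h1 := Metric.mem_closedBall.1 hx
        have h2 := Metric.mem_closedBall'.1 hy
        linarith [dist_triangle x (c i) y]
    have h2 := (ENNReal.lt_ofReal_iff_toReal_lt htop).1 (lt_of_lt_of_le hi h1)
    change δ.toReal / 2 < r i
    linarith
  obtain ⟨K, hKE, hK, hKU⟩ := AnalyticSet.exists_isCompact_forall_isOpen hE.analyticSet
    (c := coverContent B w)
    (fun F hF h => exists_lt_coverContent_of_iUnion (fun i => Metric.isClosed_closedBall) hdiam hF h)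
    (ha.trans_le (radiusContent_le_coverContent s E c hr))
  refine ⟨K, hKE, hK, ?_⟩
  have hκs : ENNReal.ofReal (κ ^ 2) ^ s ≠ 0 := by
    simp [ENNReal.rpow_eq_zero_iff, hκ0.ne', hs.not_gt]
  have hκt : ENNReal.ofReal (κ ^ 2) ^ s ≠ ∞ := ENNReal.rpow_ne_top_of_nonneg hs.le (by simp)
  rw [mul_comm, ← ENNReal.div_le_iff hκs hκt]
  refine le_iInf fun I => le_iInf fun x => le_iInf fun ρ => le_iInf fun hρ => le_iInf fun hcov => ?_
  rw [ENNReal.div_le_iff hκs hκt, mul_comm, ← ENNReal.tsum_mul_left]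
  -- One factor `κ` opens up the closed balls covering `K`; passing to the countable family costs
  -- the second.
  obtain ⟨A, hAU, hA⟩ := hKU (⋃ i, Metric.ball (x i) (κ * ρ i))
    (isOpen_iUnion fun i => Metric.isOpen_ball)
    (hcov.trans (iUnion_mono fun i => Metric.closedBall_subset_ball (by nlinarith [hρ i])))
  let J : Set I := {i | (Metric.ball (x i) (κ * ρ i) ∩ E).Nonempty}
  have : Nonempty ι := by
    rcases A.eq_empty_or_nonempty with rfl | ⟨z, hz⟩
    · simp at hA
    · obtain ⟨i, -⟩ := hball z 1 ⟨z, Metric.mem_ball_self one_pos, (hAU hz).2⟩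
      exact ⟨i⟩
  choose! f hf hfr using fun i (hi : i ∈ J) => hball _ _ hi
  have hAJ : A ⊆ ⋃ i ∈ J, B (f i) := by
    intro z hz
    obtain ⟨i, hi⟩ := mem_iUnion.1 (hAU hz).1
    have hiJ : i ∈ J := ⟨z, hi, (hAU hz).2⟩
    exact mem_biUnion hiJ (hf i hiJ ⟨hi, (hAU hz).2⟩)
  refine hA.le.trans ((OuterMeasure.le_tsum_of_subset_biUnion _ hAJ (w := w ∘ f) fun i _ =>
    (OuterMeasure.boundedBy_le _).trans (coverCost_le B w _)).trans
    (ENNReal.tsum_le_tsum fun i => ?_))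
  by_cases hi : i ∈ J
  · rw [indicator_of_mem hi, Function.comp_apply, hw, ← ENNReal.mul_rpow_of_nonneg _ _ hs.le,
      ← ENNReal.ofReal_mul (by positivity)]
    refine ENNReal.rpow_le_rpow (ENNReal.ofReal_le_ofReal ?_) hs.le
    nlinarith [hfr i hi]
  · simp [hi]

end RadiusContent

/-! ### Vitali covering and fractional covers -/

section Vitali

variable {X ι : Type*} [MetricSpace X]

/-- Vitali's covering lemma for finitely many open balls, with the factor `3`. -/
lemma exists_pairwiseDisjoint_ball_three (c : ι → X) {r : ι → ℝ} (t : Finset ι)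
    (hr : ∀ i ∈ t, 0 < r i) :
    ∃ J ⊆ t, (J : Set ι).PairwiseDisjoint (fun i => Metric.ball (c i) (r i)) ∧
      ∀ i ∈ t, ∃ j ∈ J, Metric.ball (c i) (r i) ⊆ Metric.ball (c j) (3 * r j) := by
  classical
  induction t using Finset.strongInduction with
  | H t ih =>
    rcases t.eq_empty_or_nonempty with rfl | hne
    · exact ⟨∅, by simp⟩
    obtain ⟨k, hk, hmax⟩ := t.exists_max_image r hne
    let t' := t.filter fun i => Disjoint (Metric.ball (c i) (r i)) (Metric.ball (c k) (r k))
    have ht' : t' ⊂ t := by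
      refine Finset.filter_ssubset.2 ⟨k, hk, fun h => ?_⟩
      exact (Metric.nonempty_ball.2 (hr k hk)).ne_empty (disjoint_self.1 h)
    obtain ⟨J, hJ, hdisj, hcov⟩ := ih t' ht' fun i hi => hr i (ht'.subset hi)
    refine ⟨insert k J, Finset.insert_subset hk (hJ.trans ht'.subset), ?_, fun i hi => ?_⟩
    · rw [Finset.coe_insert]
      exact hdisj.insert fun j hj _ => ((Finset.mem_filter.1 (hJ hj)).2).symm
    · by_cases hik : i ∈ t'
      · obtain ⟨j, hj, h⟩ := hcov i hik
        exact ⟨j, Finset.mem_insert_of_mem hj, h⟩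
      · refine ⟨k, Finset.mem_insert_self _ _, fun y hy => ?_⟩
        have : ¬ Disjoint (Metric.ball (c i) (r i)) (Metric.ball (c k) (r k)) := fun h =>
          hik (Finset.mem_filter.2 ⟨hi, h⟩)
        obtain ⟨z, hzi, hzk⟩ := Set.not_disjoint_iff.1 this
        have h1 := Metric.mem_ball'.1 hzi
        rw [Metric.mem_ball] at *
        have := hmax i hi
        linarith [dist_triangle y (c i) z, dist_triangle y z (c k)]

/-- A finite fractional cover by balls is at least as expensive as the cheapest cover by the balls
of triple radius. -/
theorem mul_le_sum_of_fractional_cover {c : ι → X} {r : ι → ℝ} {K : Set X} (hK : K.Nonempty)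
    {v : ι → ℝ} (hv : ∀ i, 0 ≤ v i) {g : ℝ} (hg : 0 ≤ g) (t : Finset ι) (hr : ∀ i ∈ t, 0 < r i)
    (hgJ : ∀ J ⊆ t, K ⊆ ⋃ j ∈ J, Metric.ball (c j) (3 * r j) → g ≤ ∑ j ∈ J, v j)
    (p : ι → ℝ) (hp : ∀ i ∈ t, 0 ≤ p i) (u : ℝ)
    (hu : ∀ x ∈ K, u ≤ ∑ i ∈ t, p i * (Metric.ball (c i) (r i)).indicator 1 x) :
    u * g ≤ ∑ i ∈ t, p i * v i := by
  classical
  -- Induction on the support of `p`. Vitali gives disjoint balls `J` in the support whose triples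
  -- cover `K`. Subtracting the least weight `p k` along `J` lowers the height by at most `p k`
  -- (disjointness), the cost by at least `p k * g`, and removes `k` from the support.
  induction h : (t.filter fun i => 0 < p i).card using Nat.strong_induction_on
    generalizing p u with
  | h n ih =>
    rcases le_or_gt u 0 with hu0 | hu0
    · exact (mul_nonpos_of_nonpos_of_nonneg hu0 hg).trans
        (Finset.sum_nonneg fun i hi => mul_nonneg (hp i hi) (hv i))
    obtain ⟨J, hJ, hdisj, hcov⟩ := exists_pairwiseDisjoint_ball_three c
      (t.filter fun i => 0 < p i) fun i hi => hr i (Finset.mem_filter.1 hi).1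
    have hJt : J ⊆ t := hJ.trans (Finset.filter_subset _ _)
    have hKJ : K ⊆ ⋃ j ∈ J, Metric.ball (c j) (3 * r j) := by
      intro x hx
      obtain ⟨i, hi, hpos⟩ := Finset.exists_lt_of_sum_lt
        (f := fun _ => (0 : ℝ)) (by simpa using hu0.trans_le (hu x hx))
      have hxi : x ∈ Metric.ball (c i) (r i) := by
        by_contra hxi
        simp [hxi] at hpos
      have hpi : 0 < p i := by simpa [hxi] using hpos
      obtain ⟨j, hj, hij⟩ := hcov i (Finset.mem_filter.2 ⟨hi, hpi⟩)
      exact mem_biUnion hj (hij hxi)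
    have hJne : J.Nonempty := by
      obtain ⟨x, hx⟩ := hK
      obtain ⟨j, hj, _⟩ := mem_iUnion₂.1 (hKJ hx)
      exact ⟨j, hj⟩
    obtain ⟨k, hk, hmin⟩ := J.exists_min_image p hJne
    have hpk : 0 < p k := (Finset.mem_filter.1 (hJ hk)).2
    let q : ι → ℝ := fun i => p i - if i ∈ J then p k else 0
    have hq : ∀ i ∈ t, 0 ≤ q i := by
      intro i hi
      by_cases hiJ : i ∈ J
      · simpa [q, hiJ] using hmin i hiJ
      · simpa [q, hiJ] using hp i hi
    have hsum : ∀ z : ι → ℝ, ∑ i ∈ t, q i * z i = ∑ i ∈ t, p i * z i - p k * ∑ j ∈ J, z j := by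
      intro z
      simp only [q, sub_mul, Finset.sum_sub_distrib, ite_mul, zero_mul, Finset.mul_sum]
      rw [Finset.sum_ite_mem, Finset.inter_eq_right.2 hJt]
    have hcard : (t.filter fun i => 0 < q i).card < n := by
      rw [← h]
      refine Finset.card_lt_card ⟨fun i hi => ?_, fun hsub => ?_⟩
      · rw [Finset.mem_filter] at hi ⊢
        refine ⟨hi.1, hi.2.trans_le ?_⟩
        by_cases hiJ : i ∈ J <;> simp [q, hiJ, hpk.le]
      · have := (Finset.mem_filter.1 (hsub (hJ hk))).2
        simp [q, hk] at this
    have hind : ∀ x, ∑ j ∈ J, (Metric.ball (c j) (r j)).indicator (1 : X → ℝ) x ≤ 1 := by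
      intro x
      by_cases hx : ∃ j ∈ J, x ∈ Metric.ball (c j) (r j)
      · obtain ⟨j, hj, hxj⟩ := hx
        rw [Finset.sum_eq_single_of_mem j hj fun i hi hij => ?_]
        · simp [hxj]
        · exact indicator_of_notMem (fun hxi => disjoint_left.1 (hdisj hi hj hij) hxi hxj) _
      · push Not at hx
        rw [Finset.sum_eq_zero fun j hj => indicator_of_notMem (hx j hj) _]
        exact zero_le_one
    have hrec := ih _ hcard q hq (u - p k) (fun x hx => by
      rw [hsum fun i => (Metric.ball (c i) (r i)).indicator 1 x]
      nlinarith [hu x hx, hind x]) rfl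
    rw [hsum] at hrec
    nlinarith [hgJ J hJt hKJ]

end Vitali

/-! ### Duality and Frostman's lemma -/

section Frostman

/-- Finite-dimensional duality between probability measures and fractional covers. -/
lemma exists_probabilityMeasure_real_lt {Z ι : Type*} [MeasurableSpace Z] [Nonempty Z] [Fintype ι]
    {U : ι → Set Z} (hU : ∀ i, MeasurableSet (U i)) (τ : ι → ℝ)
    (h : ∀ p : ι → ℝ, 0 ≤ p → p ≠ 0 →
      ∃ z, ∑ i, p i * (U i).indicator 1 z < ∑ i, p i * τ i) :
    ∃ ν : ProbabilityMeasure Z, ∀ i, (ν : Measure Z).real (U i) < τ i := by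
  classical
  by_contra! hcon
  let O : Set (ι → ℝ) := Set.pi univ fun i => Iio (τ i)
  let Φ : ProbabilityMeasure Z → ι → ℝ := fun ν i => (ν : Measure Z).real (U i)
  have hO : IsOpen O := isOpen_set_pi finite_univ fun i _ => isOpen_Iio
  have hOc : Convex ℝ O := convex_pi fun i _ => convex_Iio _
  have hC : Convex ℝ (range Φ) := by
    rintro _ ⟨ν₁, rfl⟩ _ ⟨ν₂, rfl⟩ a b ha hb hab
    let ν : Measure Z := ENNReal.ofReal a • (ν₁ : Measure Z) + ENNReal.ofReal b • (ν₂ : Measure Z)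
    have hν : IsProbabilityMeasure ν := ⟨by
      simp [ν, ← ENNReal.ofReal_add ha hb, hab]⟩
    refine ⟨⟨ν, hν⟩, funext fun i => ?_⟩
    change ν.real (U i) = _
    have htop : ∀ (x : ℝ) (ν' : ProbabilityMeasure Z),
        (ENNReal.ofReal x • (ν' : Measure Z)) (U i) ≠ ∞ := fun x ν' =>
      ENNReal.mul_ne_top ENNReal.ofReal_ne_top (measure_ne_top _ _)
    rw [measureReal_add_apply (htop _ _) (htop _ _), measureReal_ennreal_smul_apply, measureReal_ennreal_smul_apply,
      ENNReal.toReal_ofReal ha, ENNReal.toReal_ofReal hb]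
    rfl
  have hdisj : Disjoint O (range Φ) := by
    rw [disjoint_left]
    rintro _ hv ⟨ν, rfl⟩
    obtain ⟨i, hi⟩ := hcon ν
    exact hi.not_gt (hv i (mem_univ i))
  obtain ⟨f, u, hfO, hfC⟩ := geometric_hahn_banach_open hOc hO hC hdisj
  let p : ι → ℝ := fun i => f (Pi.single i 1)
  have hf : ∀ v : ι → ℝ, f v = ∑ i, p i * v i := by
    intro v
    have := LinearMap.pi_apply_eq_sum_univ (f : (ι → ℝ) →ₗ[ℝ] ℝ) v
    simp only [ContinuousLinearMap.coe_coe, smul_eq_mul] at this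
    rw [this]
    refine Finset.sum_congr rfl fun i _ => ?_
    rw [mul_comm]
    congr 2
    ext j
    simp [Pi.single_apply, eq_comm]
  have hdirac : ∀ z, u ≤ ∑ i, p i * (U i).indicator 1 z := by
    intro z
    have := hfC _ ⟨⟨Measure.dirac z, inferInstance⟩, rfl⟩
    rw [hf] at this
    refine this.trans_eq (Finset.sum_congr rfl fun i _ => ?_)
    by_cases hz : z ∈ U i <;>
      simp [Φ, Measure.real, Measure.dirac_apply' _ (hU i), hz]
  -- `f` is bounded above on `O`, which is unbounded downwards in each coordinate.
  have hp : 0 ≤ p := by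
    intro i
    by_contra! hi
    change p i < 0 at hi
    let n : ℝ := max 0 ((f (τ - 1) - u) / p i)
    have hn : (f (τ - 1) - u) / p i ≤ n := le_max_right _ _
    have hn0 : 0 ≤ n := le_max_left _ _
    have hmem : τ - 1 - n • Pi.single i 1 ∈ O := by
      intro j _
      rcases eq_or_ne j i with rfl | hj
      · simp; linarith
      · simp [Pi.single_eq_of_ne hj]
    have h1 := hfO _ hmem
    rw [map_sub, map_smul, smul_eq_mul] at h1
    rw [div_le_iff_of_neg hi] at hn
    change f (τ - 1) - n * p i < u at h1
    linarith
  have hτmem : ∀ ε : ℝ, 0 < ε → (τ - fun _ => ε) ∈ O := fun ε hε i _ => by simpa using hε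
  obtain ⟨z₀⟩ := ‹Nonempty Z›
  have hp0 : p ≠ 0 := by
    intro h0
    have h1 := hfO _ (hτmem 1 one_pos)
    have h2 := hdirac z₀
    rw [hf] at h1
    simp only [h0, Pi.zero_apply, zero_mul, Finset.sum_const_zero] at h1 h2
    linarith
  obtain ⟨z, hz⟩ := h p hp hp0
  have hgap : 0 < ∑ i, p i * τ i - u := by linarith [hdirac z]
  have hps : 0 ≤ ∑ i, p i := Finset.sum_nonneg fun i _ => hp i
  -- A shift of `τ` into `O` that lowers `f` by at most the gap; the `+ 1` keeps the denominator
  -- positive.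
  have h1 := hfO _ (hτmem ((∑ i, p i * τ i - u) / (∑ i, p i + 1)) (by positivity))
  rw [hf] at h1
  simp only [Pi.sub_apply, mul_sub, Finset.sum_sub_distrib, ← Finset.sum_mul] at h1
  have h2 : (∑ i, p i) * ((∑ i, p i * τ i - u) / (∑ i, p i + 1)) ≤ ∑ i, p i * τ i - u := by
    rw [mul_div_assoc', div_le_iff₀ (by positivity)]
    nlinarith
  linarith

/-- Portmanteau: the mass of an open set is lower semicontinuous. This is why the estimates use open
balls. -/
lemma isClosed_setOf_probabilityMeasure_open_le {Z : Type*} [MeasurableSpace Z] [TopologicalSpace Z]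
    [OpensMeasurableSpace Z] [HasOuterApproxClosed Z] {U : Set Z} (hU : IsOpen U) (b : ℝ≥0∞) :
    IsClosed {ν : ProbabilityMeasure Z | (ν : Measure Z) U ≤ b} := by
  refine isClosed_iff_forall_filter.2 fun ν F _ hF hν => ?_
  refine (ProbabilityMeasure.le_liminf_measure_open_of_tendsto (tendsto_id'.2 hν) hU).trans ?_
  refine (liminf_le_liminf (le_principal_iff.1 hF)).trans (liminf_const b).le

variable {X : Type*} [MetricSpace X]

/-- The hypothesis of the duality lemma for balls, in terms of the content. -/
lemma exists_sum_indicator_ball_lt {ι : Type*} [Fintype ι] {K : Set X} (hK : K.Nonempty) {s : ℝ}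
    {l : ℝ} (hl : 0 < l) (h : ENNReal.ofReal (6 ^ s * l) < radiusContent s K)
    (c : ι → X) {r : ι → ℝ} (hr : ∀ i, 0 < r i) {p : ι → ℝ} (hp : 0 ≤ p) (hp0 : p ≠ 0) :
    ∃ z : K, ∑ i, p i * (Subtype.val ⁻¹' Metric.ball (c i) (r i) : Set K).indicator 1 z
      < ∑ i, p i * (r i ^ s / l) := by
  by_contra! hcon
  obtain ⟨g, hg0, hlg, hgK⟩ := ENNReal.lt_iff_exists_real_btwn.1 h
  have hlg' : 6 ^ s * l < g := (ENNReal.ofReal_lt_ofReal_iff_of_nonneg (by positivity)).1 hlg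
  have hu : 0 < ∑ i, p i * (r i ^ s / l) := by
    obtain ⟨i, hi⟩ := Function.ne_iff.1 hp0
    refine Finset.sum_pos' (fun j _ => mul_nonneg (hp j) ?_) ⟨i, Finset.mem_univ i, mul_pos ?_ ?_⟩
    · have := hr j; positivity
    · exact lt_of_le_of_ne (hp i) (Ne.symm hi)
    · have := hr i; positivity
  -- The weight `(6 * r i) ^ s` is the price of the tripled ball, `(2 * (3 * r i)) ^ s`.
  have key := mul_le_sum_of_fractional_cover (c := c) (r := r) hK (v := fun i => (6 * r i) ^ s)
    (fun i => by have := hr i; positivity) hg0 Finset.univ (fun i _ => hr i) (fun J _ hJ => by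
      have h1 : radiusContent s K ≤ _ := radiusContent_biUnion_le (s := s) (c := c)
        (r := fun i => 3 * r i) (J : Set ι) (fun i _ => by have := hr i; positivity)
        (hJ.trans (iUnion₂_mono fun i _ => Metric.ball_subset_closedBall))
      rw [tsum_fintype, Finset.sum_indicator_subset _ (Finset.subset_univ J)] at h1
      have h2 : ∑ i ∈ J, ENNReal.ofReal (2 * (3 * r i)) ^ s
          = ENNReal.ofReal (∑ i ∈ J, (6 * r i) ^ s) := by
        rw [ENNReal.ofReal_sum_of_nonneg fun i _ => by have := hr i; positivity]
        refine Finset.sum_congr rfl fun i _ => ?_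
        rw [ENNReal.ofReal_rpow_of_pos (by have := hr i; positivity)]
        congr 2; ring
      rw [h2] at h1
      exact (ENNReal.ofReal_le_ofReal_iff
        (Finset.sum_nonneg fun i _ => by have := hr i; positivity)).1 (hgK.le.trans h1))
    p (fun i _ => hp i) _ (fun x hx => hcon ⟨x, hx⟩)
  have hsum : ∑ i, p i * (6 * r i) ^ s = 6 ^ s * l * ∑ i, p i * (r i ^ s / l) := by
    rw [Finset.mul_sum]
    refine Finset.sum_congr rfl fun i _ => ?_
    rw [Real.mul_rpow (by norm_num) (hr i).le]
    field_simp
  rw [hsum, mul_comm] at key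
  exact absurd (le_of_mul_le_mul_right key hu) hlg'.not_ge

/-- **Frostman's lemma** for compact sets, with an explicit constant. -/
theorem IsCompact.exists_isProbabilityMeasure_ball_le [MeasurableSpace X] [BorelSpace X]
    {K : Set X} (hK : IsCompact K) (hne : K.Nonempty) {s : ℝ} {l : ℝ} (hl : 0 < l)
    (h : ENNReal.ofReal (6 ^ s * l) < radiusContent s K) :
    ∃ μ : Measure X, IsProbabilityMeasure μ ∧ μ Kᶜ = 0 ∧
      ∀ x r, 0 < r → μ (Metric.ball x r) ≤ ENNReal.ofReal (r ^ s / l) := by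
  have : CompactSpace K := isCompact_iff_compactSpace.1 hK
  have : Nonempty K := hne.to_subtype
  let U : X × Ioi (0 : ℝ) → Set K := fun b => Subtype.val ⁻¹' Metric.ball b.1 b.2
  have hU : ∀ b, IsOpen (U b) := fun b => Metric.isOpen_ball.preimage continuous_subtype_val
  let F : X × Ioi (0 : ℝ) → Set (ProbabilityMeasure K) := fun b =>
    {ν | (ν : Measure K) (U b) ≤ ENNReal.ofReal ((b.2 : ℝ) ^ s / l)}
  -- Finite intersection property in the compact space of probability measures on `K`.
  have hF : (⋂ b, F b).Nonempty := by
    refine CompactSpace.iInter_nonempty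
      (fun b => isClosed_setOf_probabilityMeasure_open_le (hU b) _) fun T => ?_
    obtain ⟨ν, hν⟩ := exists_probabilityMeasure_real_lt (U := fun b : T => U b)
      (fun b => (hU b).measurableSet) (fun b => ((b : X × Ioi (0 : ℝ)).2 : ℝ) ^ s / l)
      fun p hp hp0 => exists_sum_indicator_ball_lt hne hl h
        (fun b : T => (b : X × Ioi (0 : ℝ)).1) (fun b => (b : X × Ioi (0 : ℝ)).2.2) hp hp0
    refine ⟨ν, mem_iInter₂.2 fun b hb => ?_⟩
    have := (hν ⟨b, hb⟩).le
    exact (ENNReal.ofReal_toReal (MeasureTheory.measure_ne_top (ν : Measure K) (U b))).symm.trans_le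
      (ENNReal.ofReal_le_ofReal this)
  obtain ⟨ν, hν⟩ := hF
  refine ⟨(ν : Measure K).map Subtype.val,
    Measure.isProbabilityMeasure_map measurable_subtype_coe.aemeasurable, ?_, fun x r hr => ?_⟩
  · rw [Measure.map_apply measurable_subtype_coe hK.measurableSet.compl]
    simp
  · rw [Measure.map_apply measurable_subtype_coe Metric.isOpen_ball.measurableSet]
    exact mem_iInter.1 hν (x, ⟨r, hr⟩)

end Frostman

/-! ### The two inequalities -/

section SingularValue

variable {X : Type*} [MetricSpace X] [MeasurableSpace X]

/-- A measure that is bounded by `r ^ s / b` on balls centred at points of `E` satisfies the same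
bound on all bounded sets that meet `E`, with `r` replaced by the diameter. -/
lemma mul_measure_le_ediam_rpow {s : ℝ} {E D : Set X} {μ : Measure X} {b : ℝ≥0∞}
    (hμ : ∀ x ∈ E, ∀ r : ℝ, 0 < r → b * μ (Metric.ball x r) ≤ ENNReal.ofReal r ^ s)
    (hD : Bornology.IsBounded D) (hDE : (D ∩ E).Nonempty) :
    b * μ D ≤ Metric.ediam D ^ s := by
  obtain ⟨x, hxD, hxE⟩ := hDE
  -- The ball around `x` is open, so its radius must exceed the diameter.
  have h1 : ∀ ε : ℝ, 0 < ε → b * μ D ≤ ENNReal.ofReal (Metric.diam D + ε) ^ s := by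
    intro ε hε
    have hpos : 0 < Metric.diam D + ε := by positivity
    refine le_trans (mul_le_mul_right (measure_mono fun y hy => ?_) b) (hμ x hxE _ hpos)
    rw [Metric.mem_ball]
    linarith [Metric.dist_le_diam_of_mem hD hy hxD]
  have h2 : Tendsto (fun ε : ℝ => ENNReal.ofReal (Metric.diam D + ε) ^ s) (𝓝[>] 0)
      (𝓝 (ENNReal.ofReal (Metric.diam D + 0) ^ s)) := by
    have : Continuous fun ε : ℝ => ENNReal.ofReal (Metric.diam D + ε) ^ s :=
      ENNReal.continuous_rpow_const.comp (ENNReal.continuous_ofReal.comp (by fun_prop))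
    exact (this.tendsto 0).mono_left nhdsWithin_le_nhds
  have h3 := ge_of_tendsto h2 (eventually_nhdsWithin_of_forall h1)
  rwa [add_zero, Metric.diam, ENNReal.ofReal_toReal hD.ediam_ne_top] at h3

theorem singularValue_le_hausdorffContent (s : ℝ) (E : Set X) :
    singularValue s E ≤ hausdorffContent s E := by
  refine iSup_le fun μ => iSup_le fun hμ => iSup_le fun hμE => ?_
  set b : ℝ≥0∞ := ⨅ (x : X) (_ : x ∈ E) (r : ℝ) (_ : 0 < r),
    ENNReal.ofReal r ^ s / μ (Metric.ball x r) with hb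
  refine le_iInf fun I => le_iInf fun c => le_iInf fun r => le_iInf fun hr => le_iInf fun hcov => ?_
  have hball : ∀ x ∈ E, ∀ r : ℝ, 0 < r → b * μ (Metric.ball x r) ≤ ENNReal.ofReal r ^ s := by
    intro x hx r hr
    have h1 : b ≤ ENNReal.ofReal r ^ s / μ (Metric.ball x r) :=
      (iInf₂_le x hx).trans (iInf₂_le r hr)
    exact ENNReal.mul_le_of_le_div h1
  have hone : μ E = 1 := by
    refine le_antisymm prob_le_one ?_
    calc (1 : ℝ≥0∞) = μ (E ∪ Eᶜ) := by rw [union_compl_self, measure_univ]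
      _ ≤ μ E + μ Eᶜ := measure_union_le _ _
      _ = μ E := by rw [hμE, add_zero]
  calc b = b * μ E := by rw [hone, mul_one]
    _ ≤ b * ∑' i, μ (Metric.closedBall (c i) (r i) ∩ E) := by
      refine mul_le_mul_right ((measure_mono ?_).trans (measure_iUnion_le _)) b
      rw [← iUnion_inter]
      exact subset_inter hcov Subset.rfl
    _ = ∑' i, b * μ (Metric.closedBall (c i) (r i) ∩ E) := ENNReal.tsum_mul_left.symm
    _ ≤ _ := ENNReal.tsum_le_tsum fun i => by
      rcases (Metric.closedBall (c i) (r i) ∩ E).eq_empty_or_nonempty with h | h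
      · simp [h]
      · exact (mul_le_mul_right (measure_mono inter_subset_left) b).trans
          (mul_measure_le_ediam_rpow hball Metric.isBounded_closedBall h)

/-- One ball covers `E` at cost `1`, and a Dirac mass at a point of `E` has all quotients at least
`1`. -/
lemma hausdorffContent_zero_le_singularValue {E : Set X} (hE : MeasurableSet E)
    (hb : Bornology.IsBounded E) : hausdorffContent 0 E ≤ singularValue 0 E := by
  refine (hausdorffContent_le_radiusContent le_rfl E).trans ?_
  rcases E.eq_empty_or_nonempty with rfl | ⟨x₀, hx₀⟩
  · rw [radiusContent_empty]
    exact zero_le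
  obtain ⟨R, hR⟩ := hb.subset_closedBall x₀
  have h1 : radiusContent 0 E ≤ 1 := by
    have := radiusContent_le (ι := Unit) (s := 0) (A := E) (c := fun _ => x₀)
      (r := fun _ => max R 1) (fun _ => by positivity)
      (hR.trans fun y hy => mem_iUnion.2
        ⟨(), Metric.closedBall_subset_closedBall (le_max_left R 1) hy⟩)
    simpa using this
  refine h1.trans ?_
  have hd : Measure.dirac x₀ Eᶜ = 0 := by simp [Measure.dirac_apply' x₀ hE.compl, hx₀]
  refine le_trans ?_ (le_iSup_of_le (Measure.dirac x₀)
    (le_iSup_of_le inferInstance (le_iSup_of_le hd le_rfl)))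
  refine le_iInf fun x => le_iInf fun _ => le_iInf fun r => le_iInf fun hr => ?_
  rw [ENNReal.rpow_zero, one_div, ENNReal.one_le_inv]
  exact prob_le_one

variable [BorelSpace X]

lemma ofReal_le_singularValue {s : ℝ} {E K : Set X} (hKE : K ⊆ E) (hK : IsCompact K)
    (hne : K.Nonempty) {l : ℝ} (hl : 0 < l)
    (h : ENNReal.ofReal (6 ^ s * l) < radiusContent s K) :
    ENNReal.ofReal l ≤ singularValue s E := by
  obtain ⟨μ, hμ, hμK, hball⟩ := hK.exists_isProbabilityMeasure_ball_le hne hl h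
  have hμE : μ Eᶜ = 0 := measure_mono_null (compl_subset_compl.2 hKE) hμK
  refine le_trans ?_ (le_iSup_of_le μ (le_iSup_of_le hμ (le_iSup_of_le hμE le_rfl)))
  refine le_iInf fun x => le_iInf fun _ => le_iInf fun r => le_iInf fun hr => ?_
  have hrs : 0 < r ^ s := Real.rpow_pos_of_pos hr s
  rw [ENNReal.ofReal_rpow_of_pos hr]
  refine ENNReal.le_div_iff_mul_le (Or.inr (by simpa using hrs)) (Or.inr ENNReal.ofReal_ne_top) |>.2 ?_
  refine (mul_le_mul_right (hball x r hr) _).trans_eq ?_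
  rw [← ENNReal.ofReal_mul hl.le, mul_div_cancel₀ _ hl.ne']

lemma radiusContent_le_mul_singularValue_of_isCompact {s : ℝ} {E K : Set X} (hKE : K ⊆ E)
    (hK : IsCompact K) :
    radiusContent s K ≤ (6 : ℝ≥0∞) ^ s * singularValue s E := by
  rcases K.eq_empty_or_nonempty with rfl | hne
  · rw [radiusContent_empty]
    exact zero_le
  refine le_of_forall_lt fun b hb => ?_
  obtain ⟨g, hg0, hbg, hgK⟩ := ENNReal.lt_iff_exists_real_btwn.1 hb
  have h6 : (0 : ℝ) < 6 ^ s := by positivity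
  have hg : 0 < g := ENNReal.ofReal_pos.1 (bot_le.trans_lt hbg)
  have h6s : (6 : ℝ≥0∞) ^ s = ENNReal.ofReal (6 ^ s) := by
    rw [← ENNReal.ofReal_rpow_of_pos (by norm_num)]
    norm_num
  have hl : ENNReal.ofReal (g / 6 ^ s) ≤ singularValue s E :=
    ofReal_le_singularValue hKE hK hne (by positivity) (by rwa [mul_div_cancel₀ _ h6.ne'])
  calc b < ENNReal.ofReal g := hbg
    _ = (6 : ℝ≥0∞) ^ s * ENNReal.ofReal (g / 6 ^ s) := by
      rw [h6s, ← ENNReal.ofReal_mul h6.le, mul_div_cancel₀ _ h6.ne']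
    _ ≤ _ := mul_le_mul_right hl _

theorem radiusContent_le_mul_singularValue [ProperSpace X] {s : ℝ} (hs : 0 < s) {E : Set X}
    (hE : MeasurableSet E) (hb : Bornology.IsBounded E) :
    radiusContent s E ≤ (6 : ℝ≥0∞) ^ s * singularValue s E := by
  set C := (6 : ℝ≥0∞) ^ s * singularValue s E
  refine le_of_forall_lt_imp_le_of_dense fun a ha => ?_
  have h1 : ∀ κ : ℝ, 1 < κ → a ≤ ENNReal.ofReal (κ ^ 2) ^ s * C := by
    intro κ hκ
    obtain ⟨K, hKE, hK, h⟩ := exists_isCompact_le_radiusContent hE hb hs hκ ha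
    exact h.trans (mul_le_mul_right (radiusContent_le_mul_singularValue_of_isCompact hKE hK) _)
  have h2 : Tendsto (fun κ : ℝ => ENNReal.ofReal (κ ^ 2) ^ s * C) (𝓝[>] 1)
      (𝓝 (ENNReal.ofReal (1 ^ 2) ^ s * C)) := by
    have : Continuous fun κ : ℝ => ENNReal.ofReal (κ ^ 2) ^ s :=
      ENNReal.continuous_rpow_const.comp (ENNReal.continuous_ofReal.comp (by fun_prop))
    -- `C` may be infinite; the limit of the other factor is nonzero.
    exact ENNReal.Tendsto.mul_const ((this.tendsto 1).mono_left nhdsWithin_le_nhds)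
      (Or.inl (by simp))
  simpa using ge_of_tendsto h2 (eventually_nhdsWithin_of_forall h1)

end SingularValue

theorem proposition2p1 (d : ℕ) (s : ℝ) (hs : 0 ≤ s) (E : Set (EuclideanSpace ℝ (Fin d)))
    (hE : MeasurableSet E) (hb : Bornology.IsBounded E) :
    singularValue s E ≤ hausdorffContent s E ∧
      hausdorffContent s E ≤ (6 : ℝ≥0∞) ^ s * singularValue s E := by
  refine ⟨singularValue_le_hausdorffContent s E, ?_⟩
  rcases hs.eq_or_lt with rfl | hs'
  · simpa using hausdorffContent_zero_le_singularValue hE hb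
  · exact (hausdorffContent_le_radiusContent hs E).trans
      (radiusContent_le_mul_singularValue hs' hE hb)
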